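/- **Theorem 5.3.** Let $d \in \mathbb N_0$. Write $xy = (x_1y_1,\dots,x_dy_d)$ for $x,y\in\mathbb R^d$, let $C^\infty(\mathbb R^d)$ carry its usual Fréchet topology (uniform convergence of all derivatives on compact sets), let $\mathscr E'(\mathbb R^d)$ be its dual, and let $\mathscr D'(\mathbb R^d)$ be the space of distributions on $\mathbb R^d$ with the topology of uniform convergence on bounded sets of test functions (all real- or all complex-valued). Locally integrable functions $f$ are regarded as distributions $\varphi\mapsto\int f\varphi$. A *Hadamard operator* on $\mathscr D'(\mathbb R^d)$ is a continuous linear map $L:\mathscr D'(\mathbb R^d)\to\mathscr D'(\mathbb R^d)$ which admits all monomials as eigenvectors, that is, for every $\alpha\in\mathbb N_0^d$ there is a scalar $m_\alpha$ with $L(x^\alpha)=m_\alpha x^\alpha$. Let $T\in\mathscr E'(\mathbb R^d)$, and suppose that there are finitely many functions $t_\beta\in L_1(\mathbb R^d)$ with compact support (indexed by a finite set of multi-indices $\beta\in\mathbb N_0^d$) such that $$T=\sum_\beta t_\beta^{(\beta)}$$ in the sense of distributions, and $x^{-\gamma}t_\beta(x)\in L_1(\mathbb R^d)$ for all these $\beta$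 and all $\gamma\in\mathbb N_0^d$. For $f\in C^\infty(\mathbb R^d)$ put $(M_Tf)(y)=T_x f(xy)$, $y\in\mathbb R^d$. Then $M_T$ maps $C^\infty(\mathbb R^d)$ into $C^\infty(\mathbb R^d)$ and extends to a Hadamard operator on $\mathscr D'(\mathbb R^d)$: there is a Hadamard operator $L$ on $\mathscr D'(\mathbb R^d)$ with $L(f)=M_Tf$ for all $f\in C^\infty(\mathbb R^d)$. -/

import Mathlib

open MeasureTheory Topology
open scoped Distributions ContDiff

noncomputable section

namespace HadamardOperator

/-! ### The Fréchet space `C^∞(ℝ^d)` and its dual `E'(ℝ^d)` -/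

/-- The space `C^∞(ℝ^d)` of smooth functions with values in `𝕜` (which is `ℝ` or `ℂ`). -/
structure SmoothFun (d : ℕ) (𝕜 : Type*) [RCLike 𝕜] where
  /-- The underlying function. -/
  toFun : (Fin d → ℝ) → 𝕜
  /-- The function has continuous derivatives of all orders. -/
  contDiff' : ContDiff ℝ ∞ toFun

variable {d : ℕ} {𝕜 : Type*} [RCLike 𝕜]

namespace SmoothFun

instance : FunLike (SmoothFun d 𝕜) (Fin d → ℝ) 𝕜 where
  coe f := f.toFun
  coe_injective f g h := by cases f; cases g; congr

theorem contDiff (f : SmoothFun d 𝕜) : ContDiff ℝ ∞ f := f.contDiff'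

@[ext]
theorem ext {f g : SmoothFun d 𝕜} (h : ∀ x, f x = g x) : f = g := DFunLike.ext _ _ h

@[simp]
theorem coe_mk (f : (Fin d → ℝ) → 𝕜) (hf : ContDiff ℝ ∞ f) : ⇑(mk f hf) = f := rfl

/-! The vector space operations are the pointwise ones. -/

instance : Zero (SmoothFun d 𝕜) := ⟨⟨0, contDiff_const⟩⟩

instance : IsZeroApply (SmoothFun d 𝕜) (Fin d → ℝ) 𝕜 := ⟨fun _ => rfl⟩

instance : Add (SmoothFun d 𝕜) := ⟨fun f g => ⟨f + g, f.contDiff.add g.contDiff⟩⟩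

instance : IsAddApply (SmoothFun d 𝕜) (Fin d → ℝ) 𝕜 := ⟨fun _ _ _ => rfl⟩

instance : Neg (SmoothFun d 𝕜) := ⟨fun f => ⟨-f, f.contDiff.neg⟩⟩

instance : IsNegApply (SmoothFun d 𝕜) (Fin d → ℝ) 𝕜 := ⟨fun _ _ => rfl⟩

instance : Sub (SmoothFun d 𝕜) := ⟨fun f g => ⟨f - g, f.contDiff.sub g.contDiff⟩⟩

instance : IsSubApply (SmoothFun d 𝕜) (Fin d → ℝ) 𝕜 := ⟨fun _ _ _ => rfl⟩

instance {R : Type*} [Semiring R] [Module R 𝕜] [SMulCommClass ℝ R 𝕜] [ContinuousConstSMul R 𝕜] :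
    SMul R (SmoothFun d 𝕜) := ⟨fun c f => ⟨c • f, f.contDiff.const_smul c⟩⟩

instance {R : Type*} [Semiring R] [Module R 𝕜] [SMulCommClass ℝ R 𝕜] [ContinuousConstSMul R 𝕜] :
    IsSMulApply R (SmoothFun d 𝕜) (Fin d → ℝ) 𝕜 := ⟨fun _ _ _ => rfl⟩

instance : AddCommGroup (SmoothFun d 𝕜) := FunLike.addCommGroup

instance {R : Type*} [Semiring R] [Module R 𝕜] [SMulCommClass ℝ R 𝕜] [ContinuousConstSMul R 𝕜] :
    Module R (SmoothFun d 𝕜) := FunLike.module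

/-- The `k`-th total derivative of a smooth function, as a continuous function on `ℝ^d`. -/
def iteratedDerivative (k : ℕ) (f : SmoothFun d 𝕜) : C(Fin d → ℝ, (Fin d → ℝ) [×k]→L[ℝ] 𝕜) where
  toFun := iteratedFDeriv ℝ k f
  continuous_toFun := f.contDiff.continuous_iteratedFDeriv (mod_cast le_top)

/-- The usual Fréchet topology of `C^∞(ℝ^d)`: uniform convergence of all derivatives on compact
sets. (The topology of `C(X, Y)` in Mathlib is the compact-open one.) -/
instance : TopologicalSpace (SmoothFun d 𝕜) :=
  ⨅ k : ℕ, TopologicalSpace.induced (iteratedDerivative k) inferInstance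

/-- For `y ∈ ℝ^d`, the function `x ↦ f (x y)`, with `x y = (x₁ y₁, …, x_d y_d)`. -/
def dilate (y : Fin d → ℝ) (f : SmoothFun d 𝕜) : SmoothFun d 𝕜 :=
  mk (fun x => f (x * y)) (f.contDiff.comp (by fun_prop))

/-- The monomial `x^α = x₁^{α₁} ⋯ x_d^{α_d}`. -/
def monomial (d : ℕ) (𝕜 : Type*) [RCLike 𝕜] (α : Fin d → ℕ) : SmoothFun d 𝕜 :=
  mk (fun x => ((∏ j, x j ^ α j : ℝ) : 𝕜))
    ((RCLike.ofRealCLM (K := 𝕜)).contDiff.comp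
      (contDiff_prod fun j _ => (contDiff_apply ℝ ℝ j).pow (α j)))

/-- A test function as an element of `C^∞(ℝ^d)`. -/
def ofTestFunction (φ : 𝓓((⊤ : TopologicalSpace.Opens (Fin d → ℝ)), ℝ)) : SmoothFun d 𝕜 :=
  mk (fun x => (φ x : 𝕜)) ((RCLike.ofRealCLM (K := 𝕜)).contDiff.comp φ.contDiff)

end SmoothFun

variable (d 𝕜) in
/-- The space `E'(ℝ^d)`: the dual of the Fréchet space `C^∞(ℝ^d)`. -/
abbrev CompactDistribution := SmoothFun d 𝕜 →L[𝕜] 𝕜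

/-! ### Distributions on `ℝ^d` -/

variable (d 𝕜) in
/-- The space `D'(ℝ^d)` of distributions with values in `𝕜`, with the topology of uniform
convergence on compact (equivalently, on bounded) sets of test functions. As always in Mathlib,
the test functions are real-valued; for `𝕜 = ℂ`, this is the usual space of complex distributions,
each of which is determined by its values on real-valued test functions. -/
abbrev Dist := 𝓓'((⊤ : TopologicalSpace.Opens (Fin d → ℝ)), 𝕜)

/-- The distribution `φ ↦ ∫ φ f` of a locally integrable function `f` on `ℝ^d`. (For a function
which is not locally integrable this is zero.) -/
def ofFun (f : (Fin d → ℝ) → 𝕜) : Dist d 𝕜 :=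
  (TestFunction.integralAgainstBilinCLM (ContinuousLinearMap.lsmul ℝ ℝ) volume f :
    𝓓((⊤ : TopologicalSpace.Opens (Fin d → ℝ)), ℝ) →L[ℝ] 𝕜)

theorem ofFun_apply {f : (Fin d → ℝ) → 𝕜} (hf : LocallyIntegrable f volume)
    (φ : 𝓓((⊤ : TopologicalSpace.Opens (Fin d → ℝ)), ℝ)) :
    ofFun f φ = ∫ x, φ x • f x := by
  have h : LocallyIntegrableOn f ((⊤ : TopologicalSpace.Opens (Fin d → ℝ)) : Set (Fin d → ℝ))
      volume := hf.locallyIntegrableOn _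
  exact TestFunction.integralAgainstBilinCLM_eq_integral h

/-- The distributional derivative `S^{(β)}`, for a multi-index `β`. -/
def partialDeriv (β : Fin d → ℕ) : Dist d 𝕜 →L[ℝ] Dist d 𝕜 :=
  (List.ofFn fun j : Fin d =>
    (LineDeriv.lineDerivOpCLM ℝ (Dist d 𝕜) (Pi.single j (1 : ℝ) : Fin d → ℝ)) ^ β j).prod

theorem continuous_ofTestFunction_ofSupportedIn (K : TopologicalSpace.Compacts (Fin d → ℝ))
    (hK : (K : Set (Fin d → ℝ)) ⊆ (⊤ : TopologicalSpace.Opens (Fin d → ℝ))) :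
    Continuous fun f : 𝓓_{K}((Fin d → ℝ), ℝ) =>
      (SmoothFun.ofTestFunction (TestFunction.ofSupportedIn hK f) : SmoothFun d 𝕜) := by
  refine continuous_iInf_rng.2 fun k => continuous_induced_rng.2 ?_
  have h1 : Continuous fun f : 𝓓_{K}((Fin d → ℝ), ℝ) =>
      ContDiffMapSupportedIn.structureMapCLM ℝ ⊤ k
        (ContDiffMapSupportedIn.postcompCLM (RCLike.ofRealCLM (K := 𝕜)) f) := by
    fun_prop
  have h2 : Continuous fun g : BoundedContinuousFunction (Fin d → ℝ)
      ((Fin d → ℝ) [×k]→L[ℝ] 𝕜) => g.toContinuousMap :=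
    ContinuousMap.continuous_of_continuous_uncurry _ continuous_eval
  refine (h2.comp h1).congr fun f => ContinuousMap.ext fun x => ?_
  exact congrFun (ContDiffMapSupportedIn.structureMapCLM_top_apply ℝ
    (ContDiffMapSupportedIn.postcompCLM (RCLike.ofRealCLM (K := 𝕜)) f)) x

/-- An element of `E'(ℝ^d)` as a distribution on `ℝ^d`, by restriction to the test functions. -/
def CompactDistribution.toDist (T : CompactDistribution d 𝕜) : Dist d 𝕜 :=
  (TestFunction.mkCLM ℝ (fun φ => T (SmoothFun.ofTestFunction φ))
    (fun φ ψ => by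
      rw [← map_add]
      congr 1
      exact SmoothFun.ext fun x => RCLike.ofReal_add (K := 𝕜) (φ x) (ψ x))
    (fun c φ => by
      have h : (SmoothFun.ofTestFunction (c • φ) : SmoothFun d 𝕜) =
          (c : 𝕜) • SmoothFun.ofTestFunction φ :=
        SmoothFun.ext fun x => RCLike.ofReal_mul (K := 𝕜) c (φ x)
      rw [h, map_smul, RCLike.real_smul_eq_coe_smul (K := 𝕜)])
    (fun K hK => T.continuous.comp (continuous_ofTestFunction_ofSupportedIn K hK)) :
    𝓓((⊤ : TopologicalSpace.Opens (Fin d → ℝ)), ℝ) →L[ℝ] 𝕜)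

theorem CompactDistribution.toDist_apply (T : CompactDistribution d 𝕜)
    (φ : 𝓓((⊤ : TopologicalSpace.Opens (Fin d → ℝ)), ℝ)) :
    T.toDist φ = T (SmoothFun.ofTestFunction φ) := rfl

/-! ### Hadamard operators -/

/-- The function `M_T f : y ↦ T_x f(x y)` for `T ∈ E'(ℝ^d)` and `f ∈ C^∞(ℝ^d)`. -/
def starMap (T : CompactDistribution d 𝕜) (f : SmoothFun d 𝕜) : (Fin d → ℝ) → 𝕜 :=
  fun y => T (f.dilate y)

variable (d 𝕜) in
/-- The set of Hadamard operators on `D'(ℝ^d)`: the continuous linear operators which admit all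
monomials as eigenvectors. -/
def hadamardOperators : Set (Dist d 𝕜 →L[𝕜] Dist d 𝕜) :=
  {L | ∀ α : Fin d → ℕ, ∃ m : 𝕜,
    L (ofFun (SmoothFun.monomial d 𝕜 α)) = m • ofFun (SmoothFun.monomial d 𝕜 α)}

end HadamardOperator

end

noncomputable section

namespace HadamardOperator

variable {d : ℕ} {𝕜 : Type*} [RCLike 𝕜]

/-- The partial derivative of a function in the direction of the `j`-th coordinate. -/
def coordDeriv {F : Type*} [NormedAddCommGroup F] [NormedSpace ℝ F] (j : Fin d)
    (f : (Fin d → ℝ) → F) : (Fin d → ℝ) → F :=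
  fun x => fderiv ℝ f x (Pi.single j 1)

section coordDeriv

variable {F : Type*} [NormedAddCommGroup F] [NormedSpace ℝ F] {f : (Fin d → ℝ) → F}

theorem contDiff_coordDeriv (hf : ContDiff ℝ ∞ f) (j : Fin d) :
    ContDiff ℝ ∞ (coordDeriv j f) :=
  (hf.fderiv_right (m := ∞) (by simp)).clm_apply contDiff_const

theorem hasCompactSupport_coordDeriv (hf : HasCompactSupport f) (j : Fin d) :
    HasCompactSupport (coordDeriv j f) :=
  hf.fderiv_apply ℝ _

theorem norm_iteratedFDeriv_coordDeriv_le (hf : ContDiff ℝ ∞ f) (j : Fin d) (k : ℕ)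
    (x : Fin d → ℝ) :
    ‖iteratedFDeriv ℝ k (coordDeriv j f) x‖ ≤ ‖iteratedFDeriv ℝ (k + 1) f x‖ := by
  have h := norm_iteratedFDeriv_clm_apply_const (𝕜 := ℝ) (f := fderiv ℝ f)
    (c := (Pi.single j 1 : Fin d → ℝ)) (x := x) (N := ∞) (n := k)
    (hf.fderiv_right (m := ∞) (by simp)).contDiffAt (mod_cast le_top)
  rw [norm_iteratedFDeriv_fderiv] at h
  simpa [Pi.norm_single] using! h

theorem fderiv_apply_eq_sum (x v : Fin d → ℝ) :
    fderiv ℝ f x v = ∑ j, v j • coordDeriv j f x := by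
  conv_lhs => rw [← Finset.univ_sum_single v]
  rw [map_sum]
  refine Finset.sum_congr rfl fun j _ => ?_
  rw [coordDeriv, ← map_smul, ← Pi.single_smul, smul_eq_mul, mul_one]

end coordDeriv

/-- The function `z ↦ ∫ w(x) φ(a(x) z) dx`. -/
def dilationAverage (a : (Fin d → ℝ) → Fin d → ℝ) (w φ : (Fin d → ℝ) → 𝕜) (z : Fin d → ℝ) : 𝕜 :=
  ∫ x, w x * φ (a x * z)

/-- All products of `w` with a monomial in the coordinates of `a` are integrable. -/
def IsWeight (a : (Fin d → ℝ) → Fin d → ℝ) (w : (Fin d → ℝ) → 𝕜) : Prop :=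
  ∀ γ : Fin d → ℕ, Integrable (fun x => (∏ j, a x j ^ γ j) • w x) volume

variable {a : (Fin d → ℝ) → Fin d → ℝ} {w φ : (Fin d → ℝ) → 𝕜}

theorem IsWeight.integrable (hw : IsWeight a w) : Integrable w volume := by
  simpa using hw 0

theorem IsWeight.coord_smul (hw : IsWeight a w) (j : Fin d) :
    IsWeight a fun x => a x j • w x := by
  intro γ
  refine (hw (γ + Pi.single j 1)).congr (ae_of_all _ fun x => ?_)
  have : ∏ i, a x i ^ (γ + Pi.single j 1 : Fin d → ℕ) i = (∏ i, a x i ^ γ i) * a x j := by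
    simp only [Pi.add_apply, pow_add, Finset.prod_mul_distrib]
    congr 1
    rw [Finset.prod_eq_single j] <;> simp +contextual
  simp only [this, mul_smul]

theorem exists_norm_le (hφ : Continuous φ) (hc : HasCompactSupport φ) : ∃ C, ∀ x, ‖φ x‖ ≤ C :=
  hφ.bounded_above_of_compact_support hc

theorem aestronglyMeasurable_mul_comp (ha : Measurable a) (hw : AEStronglyMeasurable w volume)
    (hφ : Continuous φ) (z : Fin d → ℝ) :
    AEStronglyMeasurable (fun x => w x * φ (a x * z)) volume :=
  hw.mul (hφ.comp_aestronglyMeasurable (ha.mul_const z).aestronglyMeasurable)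

theorem integrable_mul_comp (ha : Measurable a) (hw : Integrable w volume)
    (hφ : Continuous φ) (hc : HasCompactSupport φ) (z : Fin d → ℝ) :
    Integrable (fun x => w x * φ (a x * z)) volume := by
  obtain ⟨C, hC⟩ := exists_norm_le hφ hc
  refine (hw.norm.mul_const C).mono' (aestronglyMeasurable_mul_comp ha hw.1 hφ z)
    (ae_of_all _ fun x => ?_)
  rw [norm_mul]
  exact mul_le_mul_of_nonneg_left (hC _) (norm_nonneg _)

/-- The continuous linear map `c ↦ (v ↦ v_j c)`. -/
def coordTensor (𝕜 : Type*) [RCLike 𝕜] (j : Fin d) : 𝕜 →L[ℝ] (Fin d → ℝ) →L[ℝ] 𝕜 :=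
  ContinuousLinearMap.smulRightL ℝ (Fin d → ℝ) 𝕜 (ContinuousLinearMap.proj j)

theorem coordTensor_apply (j : Fin d) (c : 𝕜) (v : Fin d → ℝ) :
    coordTensor 𝕜 j c v = v j • c := rfl

theorem hasFDerivAt_dilationAverage (ha : Measurable a) (hw : IsWeight a w)
    (hφ : ContDiff ℝ ∞ φ) (hc : HasCompactSupport φ) (z : Fin d → ℝ) :
    HasFDerivAt (dilationAverage a w φ)
      (∑ j, coordTensor 𝕜 j
        (dilationAverage a (fun x => a x j • w x) (coordDeriv j φ) z)) z := by
  have hi : ∀ j, Integrable (fun x => (a x j • w x) * coordDeriv j φ (a x * z)) volume :=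
    fun j => integrable_mul_comp ha (hw.coord_smul j).integrable
      (contDiff_coordDeriv hφ j).continuous (hasCompactSupport_coordDeriv hc j) z
  choose C hC using fun j => exists_norm_le (contDiff_coordDeriv hφ j).continuous
    (hasCompactSupport_coordDeriv hc j)
  have key := hasFDerivAt_integral_of_dominated_of_fderiv_le (𝕜 := ℝ) (μ := volume)
    (F := fun z x => w x * φ (a x * z)) (x₀ := z) (s := Set.univ)
    (F' := fun z x => ∑ j, coordTensor 𝕜 j ((a x j • w x) * coordDeriv j φ (a x * z)))
    (bound := fun x => ∑ j, ‖coordTensor 𝕜 j‖ * (‖a x j • w x‖ * C j))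
    Filter.univ_mem
    (Filter.Eventually.of_forall fun z =>
      aestronglyMeasurable_mul_comp ha hw.integrable.1 hφ.continuous z)
    (integrable_mul_comp ha hw.integrable hφ.continuous hc z)
    (Finset.aestronglyMeasurable_fun_sum _ fun j _ =>
      (coordTensor 𝕜 j).continuous.comp_aestronglyMeasurable (hi j).1)
    (ae_of_all _ fun x z _ => (norm_sum_le _ _).trans <| Finset.sum_le_sum fun j _ =>
      ((coordTensor 𝕜 j).le_opNorm _).trans <| by
        rw [norm_mul]
        gcongr
        exact hC j _)
    (integrable_finsetSum _ fun j _ =>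
      ((hw.coord_smul j).integrable.norm.mul_const _).const_mul _)
    (ae_of_all _ fun x z _ => by
      have h1 : HasFDerivAt φ (fderiv ℝ φ (a x * z)) (a x * z) :=
        (hφ.differentiable (by simp) _).hasFDerivAt
      have h2 : HasFDerivAt (fun z => a x * z) (ContinuousLinearMap.mul ℝ (Fin d → ℝ) (a x)) z :=
        (ContinuousLinearMap.mul ℝ (Fin d → ℝ) (a x)).hasFDerivAt
      have h3 := (h1.comp z h2).const_mul (w x)
      refine h3.congr_fderiv (ContinuousLinearMap.ext fun v => ?_)
      simp only [smul_apply, ContinuousLinearMap.comp_apply,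
        ContinuousLinearMap.mul_apply', fderiv_apply_eq_sum, sum_apply,
        coordTensor_apply, smul_eq_mul, Finset.mul_sum]
      refine Finset.sum_congr rfl fun j _ => ?_
      simp only [Pi.mul_apply, RCLike.real_smul_eq_coe_mul, RCLike.ofReal_mul]
      ring)
  refine key.congr_fderiv ?_
  rw [integral_finsetSum _ fun j _ => (coordTensor 𝕜 j).integrable_comp (hi j)]
  exact Finset.sum_congr rfl fun j _ => (coordTensor 𝕜 j).integral_comp_comm (hi j)

theorem fderiv_dilationAverage (ha : Measurable a) (hw : IsWeight a w)
    (hφ : ContDiff ℝ ∞ φ) (hc : HasCompactSupport φ) :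
    fderiv ℝ (dilationAverage a w φ) = fun z => ∑ j, coordTensor 𝕜 j
        (dilationAverage a (fun x => a x j • w x) (coordDeriv j φ) z) :=
  funext fun z => (hasFDerivAt_dilationAverage ha hw hφ hc z).fderiv

theorem contDiff_dilationAverage (ha : Measurable a) (hw : IsWeight a w)
    (hφ : ContDiff ℝ ∞ φ) (hc : HasCompactSupport φ) :
    ContDiff ℝ ∞ (dilationAverage a w φ) := by
  refine contDiff_infty.2 fun n => ?_
  induction n generalizing w φ with
  | zero =>
    exact contDiff_zero.2 (continuous_iff_continuousAt.2 fun z =>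
      (hasFDerivAt_dilationAverage ha hw hφ hc z).continuousAt)
  | succ n ih =>
    refine contDiff_succ_iff_hasFDerivAt.2 ⟨_, ?_, hasFDerivAt_dilationAverage ha hw hφ hc⟩
    exact ContDiff.sum fun j _ => (coordTensor 𝕜 j).contDiff.comp
      (ih (hw.coord_smul j) (contDiff_coordDeriv hφ j) (hasCompactSupport_coordDeriv hc j))

theorem exists_norm_iteratedFDeriv_dilationAverage_le (ha : Measurable a) (k : ℕ)
    (hw : IsWeight a w) :
    ∃ C : ℝ, 0 ≤ C ∧ ∀ (φ : (Fin d → ℝ) → 𝕜) (M : ℝ), ContDiff ℝ ∞ φ → HasCompactSupport φ →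
      (∀ i ≤ k, ∀ x, ‖iteratedFDeriv ℝ i φ x‖ ≤ M) →
      ∀ z, ‖iteratedFDeriv ℝ k (dilationAverage a w φ) z‖ ≤ C * M := by
  induction k generalizing w with
  | zero =>
    refine ⟨∫ x, ‖w x‖, by positivity, fun φ M hφ hc hM z => ?_⟩
    rw [norm_iteratedFDeriv_zero, ← integral_mul_const]
    refine norm_integral_le_of_norm_le (hw.integrable.norm.mul_const M) (ae_of_all _ fun x => ?_)
    rw [norm_mul]
    have := hM 0 le_rfl (a x * z)
    rw [norm_iteratedFDeriv_zero] at this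
    gcongr
  | succ k ih =>
    choose C hC0 hC using fun j => ih (hw.coord_smul j)
    refine ⟨∑ j, ‖coordTensor 𝕜 (d := d) j‖ * C j,
      Finset.sum_nonneg fun j _ => mul_nonneg (ContinuousLinearMap.opNorm_nonneg _) (hC0 j), fun φ M hφ hc hM z => ?_⟩
    have hs : ∀ j, ContDiff ℝ ∞ (dilationAverage a (fun x => a x j • w x) (coordDeriv j φ)) :=
      fun j => contDiff_dilationAverage ha (hw.coord_smul j)
        (contDiff_coordDeriv hφ j) (hasCompactSupport_coordDeriv hc j)
    have hk : (k : WithTop ℕ∞) ≤ ∞ := mod_cast le_top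
    rw [← norm_iteratedFDeriv_fderiv, fderiv_dilationAverage ha hw hφ hc,
      iteratedFDeriv_fun_sum_apply (f := fun j z => coordTensor 𝕜 j
        (dilationAverage a (fun x => a x j • w x) (coordDeriv j φ) z)) fun j _ =>
        (((coordTensor 𝕜 j).contDiff.comp (hs j)).of_le hk).contDiffAt, Finset.sum_mul]
    refine (norm_sum_le _ _).trans (Finset.sum_le_sum fun j _ => ?_)
    refine ((coordTensor 𝕜 j).norm_iteratedFDeriv_comp_left (hs j).contDiffAt hk).trans ?_
    rw [mul_assoc]
    gcongr
    exact hC j _ M (contDiff_coordDeriv hφ j) (hasCompactSupport_coordDeriv hc j)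
      (fun i hi x => (norm_iteratedFDeriv_coordDeriv_le hφ j i x).trans (hM _ (by lia) x)) z

end HadamardOperator
end

noncomputable section

namespace HadamardOperator

open scoped Pointwise

variable {d : ℕ} {𝕜 : Type*} [RCLike 𝕜]

/-- A smooth cutoff function, equal to `1` on the closed ball of radius `n + 1`. -/
def cutoff (d n : ℕ) : ContDiffBump (0 : Fin d → ℝ) where
  rIn := n + 1
  rOut := n + 2
  rIn_pos := by positivity
  rIn_lt_rOut := by linarith

theorem cutoff_eq_one {n : ℕ} {x : Fin d → ℝ} (hx : ‖x‖ ≤ n + 1) : cutoff d n x = 1 :=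
  (cutoff d n).one_of_mem_closedBall (by simpa using! hx)

theorem cutoff_eventuallyEq_one {n : ℕ} {x : Fin d → ℝ} (hx : ‖x‖ ≤ n) :
    cutoff d n =ᶠ[𝓝 x] 1 := by
  have : ∀ᶠ y in 𝓝 x, ‖y‖ < n + 1 :=
    continuous_norm.continuousAt.eventually_lt_const (by linarith)
  filter_upwards [this] with y hy using cutoff_eq_one hy.le

/-- The product of a function with a smooth cutoff function. -/
def truncate (n : ℕ) (g : (Fin d → ℝ) → 𝕜) : (Fin d → ℝ) → 𝕜 := fun x => cutoff d n x • g x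

theorem contDiff_truncate (n : ℕ) {g : (Fin d → ℝ) → 𝕜} (hg : ContDiff ℝ ∞ g) :
    ContDiff ℝ ∞ (truncate n g) :=
  (cutoff d n).contDiff.smul hg

theorem hasCompactSupport_truncate (n : ℕ) (g : (Fin d → ℝ) → 𝕜) :
    HasCompactSupport (truncate n g) :=
  (cutoff d n).hasCompactSupport.smul_right

theorem truncate_eventuallyEq {n : ℕ} {x : Fin d → ℝ} (hx : ‖x‖ ≤ n) (g : (Fin d → ℝ) → 𝕜) :
    truncate n g =ᶠ[𝓝 x] g := by
  filter_upwards [cutoff_eventuallyEq_one hx] with y hy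
  simp [truncate, hy]

theorem exists_nat_norm_le {K : Set (Fin d → ℝ)} (hK : IsCompact K) :
    ∃ n : ℕ, ∀ x ∈ K, ‖x‖ ≤ n := by
  obtain ⟨C, hC⟩ := hK.isBounded.exists_norm_le
  obtain ⟨n, hn⟩ := exists_nat_ge C
  exact ⟨n, fun x hx => (hC x hx).trans hn⟩

theorem integrable_mul_continuous {t g : (Fin d → ℝ) → 𝕜} (ht : Integrable t volume)
    (hc : HasCompactSupport t) (hg : Continuous g) : Integrable (fun x => t x * g x) volume := by
  obtain ⟨C, hC⟩ := hc.isCompact.exists_bound_of_continuousOn hg.continuousOn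
  refine (ht.norm.mul_const C).mono' (ht.1.mul hg.aestronglyMeasurable) (ae_of_all _ fun x => ?_)
  by_cases hx : x ∈ tsupport t
  · rw [norm_mul]
    exact mul_le_mul_of_nonneg_left (hC x hx) (norm_nonneg _)
  · simp [image_eq_zero_of_notMem_tsupport hx]

theorem isWeight_id {t : (Fin d → ℝ) → 𝕜} (ht : Integrable t volume) (hc : HasCompactSupport t) :
    IsWeight id t := fun γ => by
  have hp : Continuous fun x : Fin d → ℝ => ((∏ j, x j ^ γ j : ℝ) : 𝕜) :=
    RCLike.continuous_ofReal.comp (by fun_prop)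
  simpa only [RCLike.real_smul_eq_coe_mul, mul_comm _ (t _)] using! integrable_mul_continuous ht hc hp

theorem contDiff_dilationAverage_id {t g : (Fin d → ℝ) → 𝕜} (ht : Integrable t volume)
    (hc : HasCompactSupport t) (hg : ContDiff ℝ ∞ g) :
    ContDiff ℝ ∞ (dilationAverage id t g) := by
  refine contDiff_iff_contDiffAt.2 fun y₀ => ?_
  have hK : IsCompact (tsupport t * Metric.closedBall y₀ 1) :=
    hc.isCompact.mul (isCompact_closedBall y₀ 1)
  obtain ⟨n, hn⟩ := exists_nat_norm_le hK
  refine (contDiff_dilationAverage measurable_id (isWeight_id ht hc) (contDiff_truncate n hg)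
    (hasCompactSupport_truncate n g)).contDiffAt.congr_of_eventuallyEq ?_
  filter_upwards [Metric.closedBall_mem_nhds y₀ one_pos] with y hy
  refine integral_congr_ae (ae_of_all _ fun x => ?_)
  by_cases hx : x ∈ tsupport t
  · simp only [id]
    rw [(truncate_eventuallyEq (hn _ (Set.mul_mem_mul hx hy)) g).eq_of_nhds]
  · simp [image_eq_zero_of_notMem_tsupport hx]

theorem integral_comp_inv_mul {F : Type*} [NormedAddCommGroup F] [NormedSpace ℝ F]
    {x : Fin d → ℝ} (hx : ∀ j, x j ≠ 0) {h : (Fin d → ℝ) → F} (hh : Continuous h) :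
    ∫ z, h (x⁻¹ * z) = |∏ j, x j| • ∫ y, h y := by
  have hdet : (Matrix.diagonal x⁻¹).det ≠ 0 := by
    rw [Matrix.det_diagonal]
    exact Finset.prod_ne_zero_iff.2 fun j _ => inv_ne_zero (hx j)
  have hmap := Real.map_matrix_volume_pi_eq_smul_volume_pi hdet
  have happ : ∀ z, Matrix.toLin' (Matrix.diagonal x⁻¹) z = x⁻¹ * z := fun z => by
    ext j; simp [Matrix.mulVec_diagonal]
  have hm : Measurable (Matrix.toLin' (Matrix.diagonal x⁻¹)) :=
    (LinearMap.continuous_of_finiteDimensional _).measurable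
  have := integral_map (μ := volume) hm.aemeasurable (f := h) hh.aestronglyMeasurable
  simp only [happ] at this
  rw [← this, hmap, integral_smul_measure, ENNReal.toReal_ofReal (abs_nonneg _),
    Matrix.det_diagonal]
  simp [Finset.prod_inv_distrib]

theorem ae_forall_coord_ne_zero : ∀ᵐ x : Fin d → ℝ, ∀ j, x j ≠ 0 :=
  Filter.eventually_all.2 fun j => Measure.ae_eval_ne (μ := fun _ => volume) j 0

/-- The weight `t(x) / |x₁ ⋯ x_d|`. -/
def inverseWeight (t : (Fin d → ℝ) → ℝ) : (Fin d → ℝ) → ℝ := fun x => |∏ j, x j|⁻¹ * t x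

theorem mem_mul_of_inverseWeight_ne_zero {t φ : (Fin d → ℝ) → ℝ} {x z : Fin d → ℝ}
    (h : inverseWeight t x * φ (x⁻¹ * z) ≠ 0) : z ∈ tsupport t * tsupport φ := by
  have hp : ∏ j, x j ≠ 0 := fun h0 => h (by simp [inverseWeight, h0])
  have ht : t x ≠ 0 := fun h0 => h (by simp [inverseWeight, h0])
  refine Set.mem_mul.2 ⟨x, subset_tsupport _ ht, x⁻¹ * z,
    subset_tsupport _ (right_ne_zero_of_mul h), ?_⟩
  ext j
  simp [mul_inv_cancel_left₀ (Finset.prod_ne_zero_iff.1 hp j (Finset.mem_univ j))]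

theorem isWeight_inverseWeight {t : (Fin d → ℝ) → ℝ}
    (ht : ∀ γ : Fin d → ℕ, Integrable (fun x : Fin d → ℝ => (∏ j, x j ^ γ j)⁻¹ * t x) volume) :
    IsWeight Inv.inv (inverseWeight t) := by
  intro γ
  have h0 : AEStronglyMeasurable t volume := by simpa using (ht 0).1
  refine (ht (γ + 1)).mono ?_ (ae_of_all _ fun x => ?_)
  · have h1 : Measurable fun x : Fin d → ℝ => ∏ j, x⁻¹ j ^ γ j := by
      simp only [Pi.inv_apply]
      fun_prop
    have h2 : Measurable fun x : Fin d → ℝ => |∏ j, x j|⁻¹ := by fun_prop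
    exact h1.aestronglyMeasurable.smul (h2.aestronglyMeasurable.mul h0)
  · simp [inverseWeight, pow_add, Finset.prod_mul_distrib, Finset.abs_prod, mul_left_comm,
      mul_assoc]

theorem integral_dilationAverage_inverseWeight_smul {t φ : (Fin d → ℝ) → ℝ} {g : (Fin d → ℝ) → 𝕜}
    (ht : Integrable t volume) (htc : HasCompactSupport t)
    (hw : Integrable (inverseWeight t) volume)
    (hφ : Continuous φ) (hφc : HasCompactSupport φ) (hg : Continuous g) :
    ∫ z, dilationAverage Inv.inv (inverseWeight t) φ z • g z =
      ∫ y, φ y • ∫ x, t x • g (x * y) := by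
  have hK : IsCompact (tsupport t * tsupport φ) := htc.isCompact.mul hφc.isCompact
  obtain ⟨Cg, hCg⟩ := hK.exists_bound_of_continuousOn hg.continuousOn
  obtain ⟨Cφ, hCφ⟩ := exists_norm_le hφ hφc
  have hA : Integrable (Function.uncurry fun z x =>
      (inverseWeight t x * φ (x⁻¹ * z)) • g z) (volume.prod volume) := by
    have hind : Integrable ((tsupport t * tsupport φ).indicator fun _ => Cφ * Cg)
        (volume : Measure (Fin d → ℝ)) :=
      (integrableOn_const hK.measure_lt_top.ne).integrable_indicator hK.measurableSet
    refine (hind.mul_prod hw.norm).mono' ?_ (ae_of_all _ fun ⟨z, x⟩ => ?_)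
    · exact (hw.1.comp_snd.mul
        (hφ.comp_aestronglyMeasurable (Measurable.aestronglyMeasurable (by fun_prop)))).smul
        (hg.comp continuous_fst).aestronglyMeasurable
    · simp only [Function.uncurry]
      by_cases h : inverseWeight t x * φ (x⁻¹ * z) = 0
      · rw [h, zero_smul, norm_zero]
        have : 0 ≤ (tsupport t * tsupport φ).indicator (fun _ => Cφ * Cg) z :=
          Set.indicator_apply_nonneg fun hz =>
            mul_nonneg ((norm_nonneg _).trans (hCφ 0)) ((norm_nonneg _).trans (hCg z hz))
        positivity
      · have hz := mem_mul_of_inverseWeight_ne_zero h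
        rw [Set.indicator_of_mem hz, norm_smul, norm_mul, mul_assoc, mul_comm]
        have := hCg z hz
        have := hCφ (x⁻¹ * z)
        gcongr
        exact (norm_nonneg _).trans (hCφ 0)
  have hB : Integrable (Function.uncurry fun x y => φ y • t x • g (x * y))
      (volume.prod volume) := by
    have hφi : Integrable φ volume := hφ.integrable_of_hasCompactSupport hφc
    refine (ht.norm.mul_prod (hφi.norm.mul_const Cg)).mono' ?_ (ae_of_all _ fun ⟨x, y⟩ => ?_)
    · exact (hφ.comp continuous_snd).aestronglyMeasurable.smul
        (ht.1.comp_fst.smul (hg.comp (continuous_fst.mul continuous_snd)).aestronglyMeasurable)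
    · simp only [Function.uncurry, norm_smul]
      by_cases hx : t x = 0
      · simp [hx]
      by_cases hy : φ y = 0
      · simp [hy]
      have := hCg _ (Set.mul_mem_mul (subset_tsupport _ hx) (subset_tsupport _ hy))
      rw [mul_left_comm]
      gcongr
  calc ∫ z, dilationAverage Inv.inv (inverseWeight t) φ z • g z
      = ∫ z, ∫ x, (inverseWeight t x * φ (x⁻¹ * z)) • g z := by
        simp only [dilationAverage, integral_smul_const]
    _ = ∫ x, ∫ z, (inverseWeight t x * φ (x⁻¹ * z)) • g z := integral_integral_swap hA
    _ = ∫ x, ∫ y, φ y • t x • g (x * y) := by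
        refine integral_congr_ae ?_
        filter_upwards [ae_forall_coord_ne_zero] with x hx
        have hp : ∏ j, x j ≠ 0 := Finset.prod_ne_zero_iff.2 fun j _ => hx j
        have hxz : ∀ z, x * (x⁻¹ * z) = z := fun z => by
          ext j; simp [mul_inv_cancel_left₀ (hx j)]
        have := integral_comp_inv_mul hx (h := fun y => φ y • t x • g (x * y)) (by fun_prop)
        rw [← inv_smul_eq_iff₀ (abs_ne_zero.2 hp), ← integral_smul] at this
        rw [← this]
        refine integral_congr_ae (ae_of_all _ fun z => ?_)
        simp only [hxz, inverseWeight, smul_smul]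
        congr 1
        ring
    _ = ∫ y, ∫ x, φ y • t x • g (x * y) := integral_integral_swap hB
    _ = ∫ y, φ y • ∫ x, t x • g (x * y) := by simp only [integral_smul]

end HadamardOperator
end

noncomputable section

namespace HadamardOperator

open scoped Pointwise

variable {d : ℕ} {𝕜 : Type*} [RCLike 𝕜]

/-- The space of real-valued test functions on `ℝ^d`. -/
abbrev Test (d : ℕ) := 𝓓((⊤ : TopologicalSpace.Opens (Fin d → ℝ)), ℝ)

section dilationAverage

variable {t : (Fin d → ℝ) → ℝ}

theorem dilationAverage_eq_zero_of_notMem {φ : (Fin d → ℝ) → ℝ} {z : Fin d → ℝ}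
    (hz : z ∉ tsupport t * tsupport φ) :
    dilationAverage Inv.inv (inverseWeight t) φ z = 0 := by
  rw [dilationAverage, ← integral_zero (Fin d → ℝ) ℝ]
  congr 1
  funext x
  by_contra h
  exact hz (mem_mul_of_inverseWeight_ne_zero h)

theorem dilationAverage_add {w φ ψ : (Fin d → ℝ) → ℝ} (hw : Integrable w volume)
    (hφ : Continuous φ) (hφc : HasCompactSupport φ) (hψ : Continuous ψ)
    (hψc : HasCompactSupport ψ) (z : Fin d → ℝ) :
    dilationAverage Inv.inv w (φ + ψ) z =
      dilationAverage Inv.inv w φ z + dilationAverage Inv.inv w ψ z := by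
  simp only [dilationAverage, Pi.add_apply, mul_add]
  exact integral_add (integrable_mul_comp measurable_inv hw hφ hφc z)
    (integrable_mul_comp measurable_inv hw hψ hψc z)

theorem dilationAverage_smul (w : (Fin d → ℝ) → ℝ) (c : ℝ) (φ : (Fin d → ℝ) → ℝ)
    (z : Fin d → ℝ) :
    dilationAverage Inv.inv w (c • φ) z = c • dilationAverage Inv.inv w φ z := by
  simp only [dilationAverage, Pi.smul_apply, smul_eq_mul, ← integral_const_mul, mul_left_comm]

/-- The operator `φ ↦ (z ↦ ∫ t(x) |x₁ ⋯ x_d|⁻¹ φ(x⁻¹ z) dx)` on the smooth functions supported in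
a compact set. -/
def dilationAverageSupportedIn (htc : HasCompactSupport t)
    (hw : IsWeight Inv.inv (inverseWeight t)) (K : TopologicalSpace.Compacts (Fin d → ℝ)) :
    𝓓_{K}((Fin d → ℝ), ℝ) →L[ℝ]
      𝓓_{(⟨tsupport t * (K : Set (Fin d → ℝ)), htc.isCompact.mul K.isCompact⟩ : TopologicalSpace.Compacts (Fin d → ℝ))}(
        (Fin d → ℝ), ℝ) :=
  ContDiffMapSupportedIn.mkCLM ℝ
    (fun φ => dilationAverage Inv.inv (inverseWeight t) φ)
    (fun φ ψ => dilationAverage_add hw.integrable φ.continuous φ.hasCompactSupport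
      ψ.continuous ψ.hasCompactSupport)
    (fun c φ => dilationAverage_smul _ c φ)
    (fun φ => contDiff_dilationAverage measurable_inv hw φ.contDiff φ.hasCompactSupport)
    (fun φ _ hz => dilationAverage_eq_zero_of_notMem fun h =>
      hz (Set.mul_subset_mul_left φ.tsupport_subset h))
    (fun k _ => by
      obtain ⟨C, hC0, hC⟩ :=
        exists_norm_iteratedFDeriv_dilationAverage_le measurable_inv k hw
      refine ⟨Finset.range (k + 1), C, hC0, fun φ z _ =>
        hC φ _ φ.contDiff φ.hasCompactSupport (fun i hi x => ?_) z⟩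
      refine (ContDiffMapSupportedIn.norm_iteratedFDeriv_apply_le_seminorm_top ℝ).trans ?_
      exact Finset.le_sup (f := fun j => ContDiffMapSupportedIn.seminorm ℝ (Fin d → ℝ) ℝ ⊤ K j)
        (Finset.mem_range.2 (by lia)) φ)

/-- The operator `φ ↦ (z ↦ ∫ t(x) |x₁ ⋯ x_d|⁻¹ φ(x⁻¹ z) dx)` on test functions. -/
def dilationAverageCLM (htc : HasCompactSupport t)
    (hw : IsWeight Inv.inv (inverseWeight t)) : Test d →L[ℝ] Test d :=
  TestFunction.mkCLM ℝ
    (fun φ => ⟨dilationAverage Inv.inv (inverseWeight t) φ,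
      contDiff_dilationAverage measurable_inv hw φ.contDiff φ.hasCompactSupport,
      HasCompactSupport.intro (htc.isCompact.mul φ.hasCompactSupport.isCompact)
        fun _ hz => dilationAverage_eq_zero_of_notMem hz, Set.subset_univ _⟩)
    (fun φ ψ => TestFunction.ext <| dilationAverage_add hw.integrable φ.continuous
      φ.hasCompactSupport ψ.continuous ψ.hasCompactSupport)
    (fun c φ => TestFunction.ext <| dilationAverage_smul _ c φ)
    (fun K _ => (TestFunction.continuous_ofSupportedIn
      (Ω := (⊤ : TopologicalSpace.Opens (Fin d → ℝ))) (Set.subset_univ _)).comp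
      (dilationAverageSupportedIn htc hw K).continuous)

theorem dilationAverageCLM_apply (htc : HasCompactSupport t)
    (hw : IsWeight Inv.inv (inverseWeight t)) (φ : Test d) :
    ⇑(dilationAverageCLM htc hw φ) = dilationAverage Inv.inv (inverseWeight t) φ := rfl

end dilationAverage

/-- Multiplication of test functions by a smooth function. -/
def mulCLM {p : (Fin d → ℝ) → ℝ} (hp : ContDiff ℝ ∞ p) : Test d →L[ℝ] Test d :=
  TestFunction.mkCLM ℝ
    (fun φ => ⟨fun x => φ x * p x, φ.contDiff.mul hp, φ.hasCompactSupport.mul_right,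
      Set.subset_univ _⟩)
    (fun _ _ => TestFunction.ext fun _ => add_mul _ _ _)
    (fun _ _ => TestFunction.ext fun _ => mul_assoc _ _ _)
    (fun _ hK => (TestFunction.continuous_ofSupportedIn hK).comp
      (ContDiffMapSupportedIn.bilinLeftCLM (ContinuousLinearMap.mul ℝ ℝ) hp).continuous)

theorem mulCLM_apply {p : (Fin d → ℝ) → ℝ} (hp : ContDiff ℝ ∞ p) (φ : Test d) (x : Fin d → ℝ) :
    mulCLM hp φ x = φ x * p x := rfl

/-- The transpose of a continuous linear operator on test functions. -/
def transpose (𝕜 : Type*) [RCLike 𝕜] (A : Test d →L[ℝ] Test d) : Dist d 𝕜 →L[𝕜] Dist d 𝕜 where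
  toFun S := ContinuousLinearMap.precompCompactConvergenceCLM 𝕜 A S
  map_add' _ _ := rfl
  map_smul' _ _ := rfl
  cont := (ContinuousLinearMap.precompCompactConvergenceCLM 𝕜 A).continuous

theorem transpose_apply (A : Test d →L[ℝ] Test d) (S : Dist d 𝕜) (φ : Test d) :
    transpose 𝕜 A S φ = S (A φ) := rfl

theorem dist_ext {S S' : Dist d 𝕜} (h : ∀ φ : Test d, S φ = S' φ) : S = S' :=
  DFunLike.ext _ _ h

theorem transpose_mulCLM_ofFun {p : (Fin d → ℝ) → ℝ} (hp : ContDiff ℝ ∞ p)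
    {g : (Fin d → ℝ) → 𝕜} (hg : Continuous g) :
    transpose 𝕜 (mulCLM hp) (ofFun g) = ofFun fun x => p x • g x := by
  refine dist_ext fun φ => ?_
  rw [transpose_apply, ofFun_apply hg.locallyIntegrable,
    ofFun_apply (f := fun x => p x • g x) (hp.continuous.smul hg).locallyIntegrable]
  simp only [mulCLM_apply, mul_smul]

theorem integrable_test_smul (φ : Test d) {g : (Fin d → ℝ) → 𝕜} (hg : Continuous g) :
    Integrable (fun x => φ x • g x) volume :=
  (φ.continuous.smul hg).integrable_of_hasCompactSupport φ.hasCompactSupport.smul_right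

theorem transpose_neg_lineDerivCLM_ofFun (j : Fin d) {g : (Fin d → ℝ) → 𝕜}
    (hg : ContDiff ℝ ∞ g) :
    transpose 𝕜 (-TestFunction.lineDerivCLM ℝ (Pi.single j 1 : Fin d → ℝ)) (ofFun g) =
      ofFun (coordDeriv j g) := by
  refine dist_ext fun φ => ?_
  rw [transpose_apply, neg_apply, map_neg, ofFun_apply hg.continuous.locallyIntegrable,
    ofFun_apply (contDiff_coordDeriv hg j).continuous.locallyIntegrable]
  have hφ : ContDiff ℝ ∞ φ := φ.contDiff
  have hd : ∀ x, TestFunction.lineDerivCLM ℝ (n := ⊤) (k := ⊤) (Pi.single j 1 : Fin d → ℝ) φ x =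
      fderiv ℝ φ x (Pi.single j 1) := fun x => by
    rw [TestFunction.lineDerivCLM_eq_fderivCLM, TestFunction.fderivCLM_apply_of_le _ le_top]
  have hi : Integrable (fun x => fderiv ℝ φ x (Pi.single j 1 : Fin d → ℝ) • g x) volume := by
    simpa only [hd] using integrable_test_smul
      (TestFunction.lineDerivCLM ℝ (n := ⊤) (k := ⊤) (Pi.single j 1 : Fin d → ℝ) φ) hg.continuous
  simp only [hd]
  exact (integral_smul_fderiv_eq_neg_fderiv_smul_of_integrable hi
    (integrable_test_smul φ (contDiff_coordDeriv hg j).continuous)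
    (integrable_test_smul φ hg.continuous)
    (fun x _ => hφ.differentiable (by simp) x) (fun x _ => hg.differentiable (by simp) x)).symm

/-- The distribution-level extension of `g ↦ (y ↦ ∫ t(x) g(x y) dx)`. -/
theorem transpose_dilationAverageCLM_ofFun {t : (Fin d → ℝ) → ℝ} (ht : Integrable t volume)
    (htc : HasCompactSupport t) (hw : IsWeight Inv.inv (inverseWeight t))
    {g : (Fin d → ℝ) → 𝕜} (hg : ContDiff ℝ ∞ g) :
    transpose 𝕜 (dilationAverageCLM htc hw) (ofFun g) =
      ofFun (dilationAverage id (fun x => (t x : 𝕜)) g) := by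
  have hc : HasCompactSupport fun x => (t x : 𝕜) := htc.comp_left RCLike.ofReal_zero
  refine dist_ext fun φ => ?_
  rw [transpose_apply, ofFun_apply hg.continuous.locallyIntegrable,
    ofFun_apply (contDiff_dilationAverage_id ht.ofReal hc hg).continuous.locallyIntegrable,
    dilationAverageCLM_apply, integral_dilationAverage_inverseWeight_smul ht htc hw.integrable
      φ.continuous φ.hasCompactSupport hg.continuous]
  simp only [dilationAverage, RCLike.real_smul_eq_coe_mul, id]

theorem ofFun_add {f g : (Fin d → ℝ) → 𝕜} (hf : Continuous f) (hg : Continuous g) :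
    (ofFun fun x => f x + g x) = ofFun f + ofFun g := by
  refine dist_ext fun φ => ?_
  rw [add_apply, ofFun_apply (f := fun x => f x + g x) (hf.add hg).locallyIntegrable,
    ofFun_apply hf.locallyIntegrable, ofFun_apply hg.locallyIntegrable]
  simp only [smul_add]
  exact integral_add (integrable_test_smul φ hf) (integrable_test_smul φ hg)

theorem ofFun_const_mul {f : (Fin d → ℝ) → 𝕜} (hf : Continuous f) (c : 𝕜) :
    (ofFun fun x => c * f x) = c • ofFun f := by
  refine dist_ext fun φ => ?_
  rw [smul_apply, ofFun_apply (f := fun x => c * f x) (hf.const_smul c).locallyIntegrable,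
    ofFun_apply hf.locallyIntegrable, smul_eq_mul, ← integral_const_mul]
  simp only [mul_smul_comm]

theorem ofFun_zero : ofFun (fun _ : Fin d → ℝ => (0 : 𝕜)) = 0 := by
  refine dist_ext fun φ => ?_
  rw [ofFun_apply (continuous_const (y := (0 : 𝕜))).locallyIntegrable, zero_apply]
  simp

theorem ofFun_sum {ι : Type*} (s : Finset ι) {f : ι → (Fin d → ℝ) → 𝕜}
    (hf : ∀ i ∈ s, Continuous (f i)) :
    (ofFun fun x => ∑ i ∈ s, f i x) = ∑ i ∈ s, ofFun (f i) := by
  classical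
  induction s using Finset.induction_on with
  | empty => simpa using ofFun_zero
  | insert i s hi ih =>
    simp only [Finset.sum_insert hi]
    rw [ofFun_add (hf i (Finset.mem_insert_self i s))
      (continuous_finsetSum s fun j hj => hf j (Finset.mem_insert_of_mem hj)),
      ih fun j hj => hf j (Finset.mem_insert_of_mem hj)]

/-- If `t` is integrable with compact support and all `x^{-γ} t` are integrable, then
`g ↦ (y ↦ ∫ t(x) g(x y) dx)` extends to a continuous linear operator on distributions. -/
theorem exists_extension_dilationAverage {t : (Fin d → ℝ) → 𝕜} (ht : Integrable t volume)
    (htc : HasCompactSupport t)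
    (hneg : ∀ γ : Fin d → ℕ, Integrable (fun x : Fin d → ℝ => (∏ j, x j ^ γ j)⁻¹ • t x) volume) :
    ∃ N : Dist d 𝕜 →L[𝕜] Dist d 𝕜, ∀ g : (Fin d → ℝ) → 𝕜, ContDiff ℝ ∞ g →
      N (ofFun g) = ofFun (dilationAverage id t g) := by
  have hr : HasCompactSupport fun x => RCLike.re (t x) := htc.comp_left (by simp)
  have hi : HasCompactSupport fun x => RCLike.im (t x) := htc.comp_left (by simp)
  have hwr := isWeight_inverseWeight (t := fun x => RCLike.re (t x)) fun γ => by
    simpa only [RCLike.smul_re] using (hneg γ).re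
  have hwi := isWeight_inverseWeight (t := fun x => RCLike.im (t x)) fun γ => by
    simpa only [RCLike.smul_im] using (hneg γ).im
  refine ⟨transpose 𝕜 (dilationAverageCLM hr hwr) +
    (RCLike.I : 𝕜) • transpose 𝕜 (dilationAverageCLM hi hwi), fun g hg => ?_⟩
  have hrc : HasCompactSupport fun x => ((RCLike.re (t x) : ℝ) : 𝕜) :=
    hr.comp_left RCLike.ofReal_zero
  have hic : HasCompactSupport fun x => ((RCLike.im (t x) : ℝ) : 𝕜) :=
    hi.comp_left RCLike.ofReal_zero
  have hR := contDiff_dilationAverage_id (𝕜 := 𝕜) ht.re.ofReal hrc hg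
  have hI := contDiff_dilationAverage_id (𝕜 := 𝕜) ht.im.ofReal hic hg
  rw [add_apply, smul_apply, transpose_dilationAverageCLM_ofFun ht.re hr hwr hg,
    transpose_dilationAverageCLM_ofFun ht.im hi hwi hg, ← ofFun_const_mul hI.continuous,
    ← ofFun_add (g := fun x => RCLike.I * _) hR.continuous (continuous_const.mul hI.continuous)]
  congr 1
  funext y
  have hg' : Continuous fun x => g (id x * y) := hg.continuous.comp (by fun_prop)
  simp only [dilationAverage]
  rw [← integral_const_mul, ← integral_add (integrable_mul_continuous ht.re.ofReal hrc hg')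
    ((integrable_mul_continuous ht.im.ofReal hic hg').const_mul _)]
  refine integral_congr_ae (ae_of_all _ fun x => ?_)
  simp only
  rw [← mul_assoc, ← add_mul, mul_comm RCLike.I, RCLike.re_add_im]

end HadamardOperator
end

noncomputable section

namespace HadamardOperator

variable {d : ℕ} {𝕜 : Type*} [RCLike 𝕜]

/-- The iterated partial derivative of a function along a list of coordinates, the head of the
list being the innermost one. -/
def iterCoordDeriv {F : Type*} [NormedAddCommGroup F] [NormedSpace ℝ F] :
    List (Fin d) → ((Fin d → ℝ) → F) → (Fin d → ℝ) → F
  | [], f => f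
  | j :: l, f => iterCoordDeriv l (coordDeriv j f)

section iterCoordDeriv

variable {F F' : Type*} [NormedAddCommGroup F] [NormedSpace ℝ F]
  [NormedAddCommGroup F'] [NormedSpace ℝ F']

theorem contDiff_iterCoordDeriv (l : List (Fin d)) {f : (Fin d → ℝ) → F} (hf : ContDiff ℝ ∞ f) :
    ContDiff ℝ ∞ (iterCoordDeriv l f) := by
  induction l generalizing f with
  | nil => exact hf
  | cons j l ih => exact ih (contDiff_coordDeriv hf j)

theorem iterCoordDeriv_clm_comp (A : F →L[ℝ] F') (l : List (Fin d)) {f : (Fin d → ℝ) → F}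
    (hf : ContDiff ℝ ∞ f) :
    iterCoordDeriv l (fun x => A (f x)) = fun x => A (iterCoordDeriv l f x) := by
  induction l generalizing f with
  | nil => rfl
  | cons j l ih =>
    have h : coordDeriv j (fun x => A (f x)) = fun x => A (coordDeriv j f x) := by
      funext x
      have h1 := (A.hasFDerivAt.comp x (hf.differentiable (by simp) x).hasFDerivAt).fderiv
      exact congr($h1 (Pi.single j 1))
    rw [iterCoordDeriv, h, ih (contDiff_coordDeriv hf j), iterCoordDeriv]

theorem iterCoordDeriv_eventuallyEq (l : List (Fin d)) {f g : (Fin d → ℝ) → F} {x : Fin d → ℝ}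
    (h : f =ᶠ[𝓝 x] g) : iterCoordDeriv l f =ᶠ[𝓝 x] iterCoordDeriv l g := by
  induction l generalizing f g with
  | nil => exact h
  | cons j l ih =>
    exact ih (h.fderiv.mono fun y hy => congr($hy (Pi.single j 1)))

theorem coordDeriv_comp_mul (j : Fin d) {f : (Fin d → ℝ) → F} (hf : ContDiff ℝ ∞ f)
    (y : Fin d → ℝ) :
    coordDeriv j (fun x => f (x * y)) = fun x => y j • coordDeriv j f (x * y) := by
  funext x
  have h1 : HasFDerivAt f (fderiv ℝ f (x * y)) (x * y) :=
    (hf.differentiable (by simp) _).hasFDerivAt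
  have h2 : HasFDerivAt (fun x => x * y)
      ((ContinuousLinearMap.mul ℝ (Fin d → ℝ)).flip y) x :=
    ((ContinuousLinearMap.mul ℝ (Fin d → ℝ)).flip y).hasFDerivAt
  have h3 := (h1.comp x h2).fderiv
  have h4 : (Pi.single j 1 : Fin d → ℝ) * y = y j • Pi.single j 1 := by
    ext i
    by_cases hi : i = j
    · subst hi; simp
    · simp [hi]
  rw [coordDeriv, coordDeriv, ← map_smul, ← h4]
  exact congr($h3 (Pi.single j 1))

theorem iterCoordDeriv_comp_mul (l : List (Fin d)) {f : (Fin d → ℝ) → F} (hf : ContDiff ℝ ∞ f)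
    (y : Fin d → ℝ) :
    iterCoordDeriv l (fun x => f (x * y)) =
      fun x => (l.map y).prod • iterCoordDeriv l f (x * y) := by
  induction l generalizing f with
  | nil => simp [iterCoordDeriv]
  | cons j l ih =>
    have hs : ContDiff ℝ ∞ fun x => coordDeriv j f (x * y) :=
      (contDiff_coordDeriv hf j).comp (by fun_prop)
    have h := iterCoordDeriv_clm_comp (y j • ContinuousLinearMap.id ℝ F) l hs
    simp only [smul_apply, ContinuousLinearMap.id_apply] at h
    rw [iterCoordDeriv, coordDeriv_comp_mul j hf, h, ih (contDiff_coordDeriv hf j)]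
    simp only [List.map_cons, List.prod_cons, mul_smul, iterCoordDeriv]

end iterCoordDeriv

theorem contDiff_list_map_prod (l : List (Fin d)) :
    ContDiff ℝ ∞ fun y : Fin d → ℝ => (l.map y).prod := by
  induction l with
  | nil => exact contDiff_const
  | cons j l ih =>
    simp only [List.map_cons, List.prod_cons]
    exact (contDiff_apply ℝ ℝ j).mul ih

/-- A multi-index as a list of coordinates. -/
def coordList (β : Fin d → ℕ) : List (Fin d) :=
  (List.ofFn fun j => List.replicate (β j) j).flatten

theorem partialDeriv_eq_prod (β : Fin d → ℕ) :
    partialDeriv (𝕜 := 𝕜) β = ((coordList β).map fun j =>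
      LineDeriv.lineDerivOpCLM ℝ (Dist d 𝕜) (Pi.single j (1 : ℝ) : Fin d → ℝ)).prod := by
  simp only [partialDeriv, coordList, List.map_flatten, List.prod_flatten, List.map_ofFn,
    Function.comp_def, List.map_replicate, List.prod_replicate]

theorem exists_test_iterCoordDeriv (l : List (Fin d)) (φ : Test d) :
    ∃ ψ : Test d, ⇑ψ = iterCoordDeriv l φ ∧ ∀ S : Dist d 𝕜,
      (l.map fun j => LineDeriv.lineDerivOpCLM ℝ (Dist d 𝕜)
        (Pi.single j (1 : ℝ) : Fin d → ℝ)).prod S φ = (-1) ^ l.length * S ψ := by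
  induction l generalizing φ with
  | nil => exact ⟨φ, rfl, fun S => by simp⟩
  | cons j l ih =>
    obtain ⟨ψ, hψ, h⟩ := ih (LineDeriv.lineDerivOp (Pi.single j (1 : ℝ) : Fin d → ℝ) φ)
    refine ⟨ψ, ?_, fun S => ?_⟩
    · rw [hψ, iterCoordDeriv]
      congr 1
    · rw [List.map_cons, List.prod_cons, mul_apply_eq_comp,
        LineDeriv.lineDerivOpCLM_apply, Distribution.lineDerivOp_apply_apply, map_neg, h,
        List.length_cons, pow_succ]
      ring

/-- The formula for `T = ∑ t_β^{(β)}`, applied to a function. -/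
def sumDerivPairing (s : Finset (Fin d → ℕ)) (t : (Fin d → ℕ) → (Fin d → ℝ) → 𝕜)
    (f : (Fin d → ℝ) → 𝕜) : 𝕜 :=
  ∑ β ∈ s, (-1) ^ (coordList β).length * ∫ x, t β x * iterCoordDeriv (coordList β) f x

section pairing

variable {T : CompactDistribution d 𝕜} {s : Finset (Fin d → ℕ)}
  {t : (Fin d → ℕ) → (Fin d → ℝ) → 𝕜}

theorem apply_ofTestFunction (ht : ∀ β ∈ s, Integrable (t β) volume)
    (hT : T.toDist = ∑ β ∈ s, partialDeriv β (ofFun (t β))) (φ : Test d) :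
    T (SmoothFun.ofTestFunction φ) =
      sumDerivPairing s t (SmoothFun.ofTestFunction φ : SmoothFun d 𝕜) := by
  rw [← CompactDistribution.toDist_apply, hT, sum_apply]
  refine Finset.sum_congr rfl fun β hβ => ?_
  obtain ⟨ψ, hψ, h⟩ := exists_test_iterCoordDeriv (𝕜 := 𝕜) (coordList β) φ
  rw [partialDeriv_eq_prod, h, ofFun_apply (ht β hβ).locallyIntegrable, hψ]
  have := iterCoordDeriv_clm_comp (RCLike.ofRealCLM (K := 𝕜)) (coordList β) φ.contDiff
  congr 2
  funext x
  rw [RCLike.real_smul_eq_coe_mul, mul_comm]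
  exact congr(t β x * $(congrFun this x)).symm

/-- The truncation of a smooth function, as a smooth function. -/
def SmoothFun.truncate (n : ℕ) (f : SmoothFun d 𝕜) : SmoothFun d 𝕜 :=
  ⟨HadamardOperator.truncate n f, contDiff_truncate n f.contDiff⟩

theorem SmoothFun.coe_truncate (n : ℕ) (f : SmoothFun d 𝕜) :
    ⇑(f.truncate n) = HadamardOperator.truncate n f := rfl

theorem SmoothFun.tendsto_truncate (f : SmoothFun d 𝕜) :
    Filter.Tendsto (fun n => f.truncate n) Filter.atTop (𝓝 f) := by
  rw [nhds_iInf]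
  refine Filter.tendsto_iInf.2 fun k => ?_
  rw [nhds_induced, Filter.tendsto_comap_iff,
    ContinuousMap.tendsto_iff_forall_isCompact_tendstoUniformlyOn]
  intro K hK u hu
  obtain ⟨N, hN⟩ := exists_nat_norm_le hK
  filter_upwards [Filter.eventually_ge_atTop N] with n hn x hx
  have hx' : ‖x‖ ≤ n := (hN x hx).trans (by exact_mod_cast hn)
  have h : iteratedFDeriv ℝ k (HadamardOperator.truncate n f) x = iteratedFDeriv ℝ k f x :=
    ((truncate_eventuallyEq hx' f).iteratedFDeriv ℝ k).eq_of_nhds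
  change (iteratedFDeriv ℝ k f x, iteratedFDeriv ℝ k (HadamardOperator.truncate n f) x) ∈ u
  rw [h]
  exact refl_mem_uniformity hu

theorem sumDerivPairing_re_add_im (ht : ∀ β ∈ s, Integrable (t β) volume)
    (hc : ∀ β ∈ s, HasCompactSupport (t β)) {f : (Fin d → ℝ) → 𝕜} (hf : ContDiff ℝ ∞ f) :
    sumDerivPairing s t f = sumDerivPairing s t (fun x => (RCLike.re (f x) : 𝕜)) +
      RCLike.I * sumDerivPairing s t (fun x => (RCLike.im (f x) : 𝕜)) := by
  have hr : ∀ l : List (Fin d), iterCoordDeriv l (fun x => ((RCLike.re (f x) : ℝ) : 𝕜)) =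
      fun x => ((RCLike.re (iterCoordDeriv l f x) : ℝ) : 𝕜) := fun l =>
    iterCoordDeriv_clm_comp ((RCLike.ofRealCLM (K := 𝕜)).comp (RCLike.reCLM (K := 𝕜))) l hf
  have hi : ∀ l : List (Fin d), iterCoordDeriv l (fun x => ((RCLike.im (f x) : ℝ) : 𝕜)) =
      fun x => ((RCLike.im (iterCoordDeriv l f x) : ℝ) : 𝕜) := fun l =>
    iterCoordDeriv_clm_comp ((RCLike.ofRealCLM (K := 𝕜)).comp (RCLike.imCLM (K := 𝕜))) l hf
  simp only [sumDerivPairing, Finset.mul_sum, ← Finset.sum_add_distrib, hr, hi]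
  refine Finset.sum_congr rfl fun β hβ => ?_
  have hg := (contDiff_iterCoordDeriv (coordList β) hf).continuous
  have hgr : Integrable (fun x =>
      t β x * ((RCLike.re (iterCoordDeriv (coordList β) f x) : ℝ) : 𝕜)) volume :=
    integrable_mul_continuous (ht β hβ) (hc β hβ)
      (RCLike.continuous_ofReal.comp (RCLike.continuous_re.comp hg))
  have hgi : Integrable (fun x =>
      t β x * ((RCLike.im (iterCoordDeriv (coordList β) f x) : ℝ) : 𝕜)) volume :=
    integrable_mul_continuous (ht β hβ) (hc β hβ)
      (RCLike.continuous_ofReal.comp (RCLike.continuous_im.comp hg))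
  rw [mul_left_comm RCLike.I, ← mul_add, ← integral_const_mul RCLike.I,
    ← integral_add hgr (hgi.const_mul _)]
  congr 2
  funext x
  rw [mul_left_comm, ← mul_add, mul_comm RCLike.I, RCLike.re_add_im]

theorem apply_eq_sumDerivPairing_of_hasCompactSupport
    (ht : ∀ β ∈ s, Integrable (t β) volume) (hc : ∀ β ∈ s, HasCompactSupport (t β))
    (hT : T.toDist = ∑ β ∈ s, partialDeriv β (ofFun (t β))) (f : SmoothFun d 𝕜)
    (hf : HasCompactSupport f) : T f = sumDerivPairing s t f := by
  let φ : Test d := ⟨fun x => RCLike.re (f x), (RCLike.reCLM (K := 𝕜)).contDiff.comp f.contDiff,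
    hf.comp_left (by simp), Set.subset_univ _⟩
  let ψ : Test d := ⟨fun x => RCLike.im (f x), (RCLike.imCLM (K := 𝕜)).contDiff.comp f.contDiff,
    hf.comp_left (by simp), Set.subset_univ _⟩
  have h : f = SmoothFun.ofTestFunction φ + (RCLike.I : 𝕜) • SmoothFun.ofTestFunction ψ :=
    SmoothFun.ext fun x => by
      have := RCLike.re_add_im (f x)
      rw [mul_comm] at this
      exact this.symm
  rw [sumDerivPairing_re_add_im ht hc f.contDiff]
  conv_lhs => rw [h, map_add, map_smul, apply_ofTestFunction ht hT, apply_ofTestFunction ht hT]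
  rfl

theorem apply_eq_sumDerivPairing
    (ht : ∀ β ∈ s, Integrable (t β) volume) (hc : ∀ β ∈ s, HasCompactSupport (t β))
    (hT : T.toDist = ∑ β ∈ s, partialDeriv β (ofFun (t β))) (f : SmoothFun d 𝕜) :
    T f = sumDerivPairing s t f := by
  refine tendsto_nhds_unique ((T.continuous.tendsto f).comp f.tendsto_truncate)
    (tendsto_const_nhds.congr' ?_)
  choose! N hN using fun β hβ => exists_nat_norm_le (hc β hβ).isCompact
  filter_upwards [Filter.eventually_ge_atTop (s.sup N)] with n hn
  rw [Function.comp_apply, apply_eq_sumDerivPairing_of_hasCompactSupport ht hc hT _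
    (f.coe_truncate n ▸ hasCompactSupport_truncate n f), f.coe_truncate n]
  refine Finset.sum_congr rfl fun β hβ => ?_
  congr 2
  funext x
  by_cases hx : x ∈ tsupport (t β)
  · have hx' : ‖x‖ ≤ n :=
      (hN β hβ x hx).trans (by exact_mod_cast (Finset.le_sup hβ).trans hn)
    rw [(iterCoordDeriv_eventuallyEq (coordList β) (truncate_eventuallyEq hx' f)).eq_of_nhds]
  · simp [image_eq_zero_of_notMem_tsupport hx]

theorem starMap_eq_sum
    (ht : ∀ β ∈ s, Integrable (t β) volume) (hc : ∀ β ∈ s, HasCompactSupport (t β))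
    (hT : T.toDist = ∑ β ∈ s, partialDeriv β (ofFun (t β))) (f : SmoothFun d 𝕜) :
    starMap T f = fun y => ∑ β ∈ s, (-1) ^ (coordList β).length *
      (((coordList β).map y).prod •
        dilationAverage id (t β) (iterCoordDeriv (coordList β) f) y) := by
  funext y
  rw [starMap, apply_eq_sumDerivPairing ht hc hT]
  refine Finset.sum_congr rfl fun β _ => ?_
  have h := iterCoordDeriv_comp_mul (coordList β) f.contDiff y
  change (-1) ^ _ * ∫ x, t β x * iterCoordDeriv (coordList β) (fun x => f (x * y)) x = _
  rw [h, dilationAverage, ← integral_smul]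
  simp only [mul_smul_comm, id]

end pairing

/-- The iterated partial derivative of distributions along a list of coordinates. -/
def iterDistDeriv (𝕜 : Type*) [RCLike 𝕜] : List (Fin d) → (Dist d 𝕜 →L[𝕜] Dist d 𝕜)
  | [] => ContinuousLinearMap.id 𝕜 _
  | j :: l => (iterDistDeriv 𝕜 l).comp
      (transpose 𝕜 (-TestFunction.lineDerivCLM ℝ (Pi.single j 1 : Fin d → ℝ)))

theorem iterDistDeriv_ofFun (l : List (Fin d)) {g : (Fin d → ℝ) → 𝕜} (hg : ContDiff ℝ ∞ g) :
    iterDistDeriv 𝕜 l (ofFun g) = ofFun (iterCoordDeriv l g) := by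
  induction l generalizing g with
  | nil => rfl
  | cons j l ih =>
    rw [iterDistDeriv, ContinuousLinearMap.comp_apply, transpose_neg_lineDerivCLM_ofFun j hg,
      ih (contDiff_coordDeriv hg j), iterCoordDeriv]

theorem starMap_monomial (T : CompactDistribution d 𝕜) (α : Fin d → ℕ) :
    starMap T (SmoothFun.monomial d 𝕜 α) =
      fun y => T (SmoothFun.monomial d 𝕜 α) * SmoothFun.monomial d 𝕜 α y := by
  funext y
  have h : (SmoothFun.monomial d 𝕜 α).dilate y =
      SmoothFun.monomial d 𝕜 α y • SmoothFun.monomial d 𝕜 α := SmoothFun.ext fun x => by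
    change ((∏ j, (x * y) j ^ α j : ℝ) : 𝕜) =
      ((∏ j, y j ^ α j : ℝ) : 𝕜) * ((∏ j, x j ^ α j : ℝ) : 𝕜)
    rw [← RCLike.ofReal_mul, ← Finset.prod_mul_distrib]
    simp only [Pi.mul_apply, mul_pow, mul_comm]
  rw [starMap, h, map_smul, smul_eq_mul, mul_comm]

/-- If `T = ∑ t_β^{(β)}` with integrable compactly supported `t_β` such that all `x^{-γ} t_β` are
integrable, then `M_T` preserves smooth functions and extends to a Hadamard operator. -/
theorem exists_mem_hadamardOperators_extending_starMap
    (T : CompactDistribution d 𝕜)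
    (s : Finset (Fin d → ℕ)) (t : (Fin d → ℕ) → (Fin d → ℝ) → 𝕜)
    (ht_int : ∀ β ∈ s, Integrable (t β) volume)
    (ht_supp : ∀ β ∈ s, HasCompactSupport (t β))
    (hT : T.toDist = ∑ β ∈ s, partialDeriv β (ofFun (t β)))
    (ht_neg : ∀ β ∈ s, ∀ γ : Fin d → ℕ,
      Integrable (fun x : Fin d → ℝ => (∏ j, x j ^ γ j)⁻¹ • t β x) volume) :
    (∀ f : SmoothFun d 𝕜, ContDiff ℝ ∞ (starMap T f)) ∧
      ∃ L ∈ hadamardOperators d 𝕜,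
        ∀ f : SmoothFun d 𝕜,
          L (ofFun f) = ofFun (starMap T f) := by
  have hft : ∀ β (f : SmoothFun d 𝕜), β ∈ s → ContDiff ℝ ∞ fun y =>
      ((coordList β).map y).prod • dilationAverage id (t β)
        (iterCoordDeriv (coordList β) f) y := fun β f hβ =>
    (contDiff_list_map_prod _).smul
      (contDiff_dilationAverage_id (ht_int β hβ) (ht_supp β hβ)
        (contDiff_iterCoordDeriv _ f.contDiff))
  choose! N hN using fun β hβ => exists_extension_dilationAverage
    (ht_int β hβ) (ht_supp β hβ) (ht_neg β hβ)
  let L : Dist d 𝕜 →L[𝕜] Dist d 𝕜 :=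
    ∑ β ∈ s, ((-1) ^ (coordList β).length : 𝕜) •
      (transpose 𝕜 (mulCLM
        (contDiff_list_map_prod (coordList β)))).comp
        ((N β).comp (iterDistDeriv 𝕜 (coordList β)))
  have hL : ∀ f : SmoothFun d 𝕜, L (ofFun f) =
      ofFun (starMap T f) := fun f => by
    have hs : ∀ β ∈ s, Continuous fun y => (-1) ^ (coordList β).length *
        (((coordList β).map y).prod •
          dilationAverage id (t β) (iterCoordDeriv (coordList β) f) y) := fun β hβ =>
      continuous_const.mul (hft β f hβ).continuous
    rw [starMap_eq_sum ht_int ht_supp hT f, ofFun_sum s hs, sum_apply]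
    refine Finset.sum_congr rfl fun β hβ => ?_
    have hg := contDiff_iterCoordDeriv (coordList β) f.contDiff
    rw [ofFun_const_mul (hft β f hβ).continuous, smul_apply,
      ContinuousLinearMap.comp_apply, ContinuousLinearMap.comp_apply,
      iterDistDeriv_ofFun _ f.contDiff, hN β hβ _ hg,
      transpose_mulCLM_ofFun _
        (contDiff_dilationAverage_id (ht_int β hβ) (ht_supp β hβ) hg).continuous]
  refine ⟨fun f => ?_, L, fun α => ⟨T (SmoothFun.monomial d 𝕜 α), ?_⟩, hL⟩
  · rw [starMap_eq_sum ht_int ht_supp hT f]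
    exact ContDiff.sum fun β hβ => contDiff_const.mul (hft β f hβ)
  · rw [hL, starMap_monomial, ofFun_const_mul
      (SmoothFun.monomial d 𝕜 α).contDiff.continuous]

end HadamardOperator

end

theorem theorem5p3 {𝕜 : Type*} [RCLike 𝕜] {d : ℕ}
    (T : HadamardOperator.CompactDistribution d 𝕜)
    (s : Finset (Fin d → ℕ)) (t : (Fin d → ℕ) → (Fin d → ℝ) → 𝕜)
    (ht_int : ∀ β ∈ s, Integrable (t β) volume)
    (ht_supp : ∀ β ∈ s, HasCompactSupport (t β))
    (hT : T.toDist = ∑ β ∈ s, HadamardOperator.partialDeriv β (HadamardOperator.ofFun (t β)))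
    (ht_neg : ∀ β ∈ s, ∀ γ : Fin d → ℕ,
      Integrable (fun x : Fin d → ℝ => (∏ j, x j ^ γ j)⁻¹ • t β x) volume) :
    (∀ f : HadamardOperator.SmoothFun d 𝕜, ContDiff ℝ ∞ (HadamardOperator.starMap T f)) ∧
      ∃ L ∈ HadamardOperator.hadamardOperators d 𝕜,
        ∀ f : HadamardOperator.SmoothFun d 𝕜,
          L (HadamardOperator.ofFun f) = HadamardOperator.ofFun (HadamardOperator.starMap T f) :=
  HadamardOperator.exists_mem_hadamardOperators_extending_starMap T s t ht_int ht_supp hT ht_neg
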